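/- A zero-error channel $\mathcal W$ from a set $\mathcal X$ to a set $\mathcal Y$ is a relation $\mathcal W\subseteq\mathcal X\times\mathcal Y$ such that $\mathcal W(x)=\{y : (x,y)\in\mathcal W\}\neq\emptyset$ for every $x\in\mathcal X$; $\mathcal W(x)$ is the set of possible outputs on input $x$. A channel $\mathcal V\subseteq\mathcal X_1\times\mathcal Y_1$ is achievable by a communication primitive $\mathcal P$, written $\mathcal P\to\mathcal V$, if there are a finite number $k$ of invocations of $\mathcal P$, an encoding of each $x\in\mathcal X_1$ as a sequence of $k$ inputs to $\mathcal P$, and a decoding of sequences of $k$ outputs of $\mathcal P$ to elements of $\mathcal Y_1$, such that for every $x\in\mathcal X_1$ and every possible sequence of outputs of the invocations on the encoding of $x$, the decoded value lies in $\mathcal V(x)$. A channel $\mathcal W$ is itself a primitive: on inputs $x_1,\dots,x_k$ the possible output sequences are those with $y_s\in\mathcal W(x_s)$ for all $s$. For an integer $a\ge 1$ let $\mathrm{List}_a$ be the channel whose input is an element $x$ of $\{1,\dots,a+1\}$ and whose possible outputs are the subsets of $\{1,\dots,a+1\}$ of size $a$ that contain $x$; let $\mathrm{List}_\infty$ be the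 trivial channel (one input, one output). The ambiguity $A(\mathcal W)$ of a channel $\mathcal W$ is the value $a\in\{1,2,\dots\}\cup\{\infty\}$ such that $\mathcal W\to\mathrm{List}_a$ and $\mathrm{List}_a\to\mathcal W$. Let $0\le t<n$ and let $\mathcal W_1,\dots,\mathcal W_n$ be zero-error channels, with $\mathcal W_i\subseteq\mathcal X_i\times\mathcal Y_i$. Their parallel concatenation $\mathcal W_p$, when up to $t$ of them may be corrupted, is the following primitive: one invocation sends one symbol over each of the $n$ channels, and a sequence of outputs $(y_{s,i})_{s\le m,\,i\le n}$ is possible on inputs $(x_{s,i})_{s\le m,\,i\le n}$ over $m$ invocations if there is a set $C\subseteq\{1,\dots,n\}$ with $|C|\le t$ (the corrupted channels, the same in all invocations) such that $y_{s,i}\in\mathcal W_i(x_{s,i})$ for all $s$ and all $i\notin C$; the outputs $y_{s,i}\in\mathcal Y_i$ with $i\in C$ are arbitrary. The ambiguity $A(\mathcal W_p)$ is the value $b\in\{1,2,\dots\}\cup\{\infty\}$ such that $\mathcal W_p\to\mathrm{List}_b$ and, for every $m$, the channel consisting of $m$ invocations of $\mathcal W_p$ is achievable by $\mathrm{List}_b$.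 **Corollary.** If all channels have the same ambiguity $A(\mathcal W_1)=\dots=A(\mathcal W_n)=A\in\{1,2,\dots\}\cup\{\infty\}$, then there is exactly one such $b$, namely \[ A(\mathcal W_p)=\left\lfloor \frac{n}{n-t}\,A\right\rfloor , \] where the right-hand side is $\infty$ if $A=\infty$. -/

import Mathlib

namespace ZeroError

universe u v u' v'

/-- A zero-error channel with input domain `X` and output range `Y`: a relation telling which
outputs are possible for each input, every input having at least one possible output. -/
structure Channel (X : Type u) (Y : Type v) where
  rel : X → Y → Prop
  total : ∀ x, ∃ y, rel x y

/-- A communication primitive, given by its joint behaviour: `uses m` is the zero-error channel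
describing which output sequences are possible when it is invoked `m` times. -/
structure Primitive (X : Type u) (Y : Type v) where
  uses : ∀ m : ℕ, Channel (Fin m → X) (Fin m → Y)

/-- A channel as a communication primitive: in each invocation every output allowed by the
channel may occur, independently of the other invocations. -/
def Channel.toPrimitive {X : Type u} {Y : Type v} (W : Channel X Y) : Primitive X Y where
  uses _ :=
    { rel := fun x y => ∀ s, W.rel (x s) (y s)
      total := fun x => ⟨fun s => (W.total (x s)).choose, fun s => (W.total (x s)).choose_spec⟩ }

/-- The parallel concatenation of the channels `W 0, …, W (n-1)`, of which up to `t` may be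
corrupted. One invocation sends one symbol over each of the `n` channels. An output sequence is
possible if, for some set `C` of at most `t` corrupted channels (the same set during all
invocations), every channel outside `C` behaves as specified in every invocation; the outputs of
the channels in `C` are arbitrary. -/
def parallel {n : ℕ} {X : Fin n → Type u} {Y : Fin n → Type v}
    (W : ∀ i, Channel (X i) (Y i)) (t : ℕ) : Primitive (∀ i, X i) (∀ i, Y i) where
  uses _ :=
    { rel := fun x y => ∃ C : Finset (Fin n), C.card ≤ t ∧
        ∀ i, i ∉ C → ∀ s, (W i).rel (x s i) (y s i)
      total := fun x => ⟨fun s i => ((W i).total (x s i)).choose, ∅, by simp,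
        fun i _ s => ((W i).total (x s i)).choose_spec⟩ }

/-- The channel `V` is achievable by the primitive `P`: there is a protocol (a number `k` of
invocations of `P`, an encoding by the sender and a decoding by the receiver) such that, for every
input and every possible output of the invocations, the receiver's output is one that `V`
allows. -/
def Primitive.Achieves {X₀ : Type u} {Y₀ : Type v} {X₁ : Type u'} {Y₁ : Type v'}
    (P : Primitive X₀ Y₀) (V : Channel X₁ Y₁) : Prop :=
  ∃ (k : ℕ) (enc : X₁ → Fin k → X₀) (dec : (Fin k → Y₀) → Y₁),
    ∀ x y, (P.uses k).rel (enc x) y → V.rel x (dec y)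

/-- Achievability `W ⟶ V` between channels. -/
def Channel.Achieves {X₀ : Type u} {Y₀ : Type v} {X₁ : Type u'} {Y₁ : Type v'}
    (W : Channel X₀ Y₀) (V : Channel X₁ Y₁) : Prop :=
  W.toPrimitive.Achieves V

/-- The list channel with parameters `0 < a < d`: the input is one of `d` values, the output is a
set of exactly `a` values containing the input. -/
def listChannel (a d : ℕ) (ha : 0 < a) (hd : a < d) :
    Channel (Fin d) {y : Finset (Fin d) // y.card = a} where
  rel x y := x ∈ y.1
  total x := by
    obtain ⟨y, hxy, -, hy⟩ := Finset.exists_subsuperset_card_eq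
      (s := {x}) (t := Finset.univ) (n := a) (by simp) (by simp; omega) (by simpa using hd.le)
    exact ⟨⟨y, hy⟩, by simpa using hxy⟩

/-- The trivial list channel, over which no communication is possible. -/
def trivialChannel : Channel Unit Unit where
  rel _ _ := True
  total _ := ⟨(), trivial⟩

/-- The channel `W` and the channel `V` achieve each other. -/
def Channel.Equivalent {X₀ : Type u} {Y₀ : Type v} {X₁ : Type u'} {Y₁ : Type v'}
    (W : Channel X₀ Y₀) (V : Channel X₁ Y₁) : Prop :=
  W.Achieves V ∧ V.Achieves W

/-- The primitive `P` and the channel `V` achieve each other: `P` achieves `V`, and any number of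
invocations of `P` can be simulated over `V`. -/
def Primitive.Equivalent {X₀ : Type u} {Y₀ : Type v} {X₁ : Type u'} {Y₁ : Type v'}
    (P : Primitive X₀ Y₀) (V : Channel X₁ Y₁) : Prop :=
  P.Achieves V ∧ ∀ m, V.Achieves (P.uses m)

/-- `a ∈ {1, 2, …} ∪ {∞}` is an ambiguity of the channel `W`: `W` and the list channel with
parameters `a` and `a + 1` (the trivial channel for `a = ∞`) achieve each other. -/
def Channel.IsAmbiguity {X : Type u} {Y : Type v} (W : Channel X Y) (a : ℕ∞) : Prop :=
  (a = ⊤ ∧ W.Equivalent trivialChannel) ∨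
    ∃ (k : ℕ) (hk : 0 < k), a = k ∧ W.Equivalent (listChannel k (k + 1) hk k.lt_succ_self)

/-- The same notion for a communication primitive. -/
def Primitive.IsAmbiguity {X : Type u} {Y : Type v} (P : Primitive X Y) (a : ℕ∞) : Prop :=
  (a = ⊤ ∧ P.Equivalent trivialChannel) ∨
    ∃ (k : ℕ) (hk : 0 < k), a = k ∧ P.Equivalent (listChannel k (k + 1) hk k.lt_succ_self)

/-- For a channel, simulating one invocation is the same as simulating any number of them. -/
theorem Channel.toPrimitive_equivalent_iff {X₀ : Type u} {Y₀ : Type v} {X₁ : Type u'}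
    {Y₁ : Type v'} (W : Channel X₀ Y₀) (V : Channel X₁ Y₁) :
    W.toPrimitive.Equivalent V ↔ W.Equivalent V := by
  refine and_congr Iff.rfl ⟨fun h => ?_, ?_⟩
  · obtain ⟨k, enc, dec, H⟩ := h 1
    exact ⟨k, fun x => enc fun _ => x, fun y => dec y 0, fun x y hy => H _ y hy 0⟩
  · rintro ⟨k, enc, dec, H⟩ m
    refine ⟨m * k, fun x j => enc (x (finProdFinEquiv.symm j).1) (finProdFinEquiv.symm j).2,
      fun y s => dec fun j => y (finProdFinEquiv (s, j)), fun x y hy s => H _ _ fun j => ?_⟩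
    have := hy (finProdFinEquiv (s, j))
    simpa using this

/-- The two notions of ambiguity agree on channels. -/
theorem Channel.toPrimitive_isAmbiguity_iff {X : Type u} {Y : Type v} (W : Channel X Y)
    (a : ℕ∞) : W.toPrimitive.IsAmbiguity a ↔ W.IsAmbiguity a := by
  simp only [Primitive.IsAmbiguity, Channel.IsAmbiguity, Channel.toPrimitive_equivalent_iff]

end ZeroError

namespace ZeroError

/-! Everything reduces to common outputs. A primitive achieves List_b exactly when, for some number
of invocations, `b + 1` input sequences have no common output; List_b simulates a channel as soon as
the inputs have finitely many codes and those behind any `b` codes share an output.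

Suppose `b + 1` codewords share an output of the parallel concatenation. Each is consistent with it
on at least `n - t` channels, while a good code lets each channel be consistent with at most `A`
codewords, so `(b + 1) * (n - t) ≤ n * A`. Conversely, if `b * (n - t) ≤ n * A`, then `b` messages
can be dealt out so that each gets `n - t` channels and no channel serves more than `A`; each
message blames its remaining channels on corruption, which produces a common output. The two bounds
meet at `b = ⌊n * A / (n - t)⌋`. If `A = ∞`, every channel has an output common to all its inputs.
-/

/-- Up to `a` input sequences to the list channel with lists of size `a` have a common output. -/
theorem exists_common_output_listChannel {ι : Type*} {κ : Type*} {a : ℕ}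
    (S : Finset ι) (hS : S.card ≤ a) (x : ι → κ → Fin (a + 1)) :
    ∃ y : κ → {y : Finset (Fin (a + 1)) // y.card = a}, ∀ j ∈ S, ∀ s, x j s ∈ (y s).1 := by
  have key (s : κ) : ∃ y : {y : Finset (Fin (a + 1)) // y.card = a}, ∀ j ∈ S, x j s ∈ y.1 := by
    obtain ⟨y, hxy, -, hy⟩ := Finset.exists_subsuperset_card_eq
      (s := S.image fun j => x j s) (t := Finset.univ) (n := a) (by simp)
      (Finset.card_image_le.trans hS) (by simp)
    exact ⟨⟨y, hy⟩, fun j hj => hxy (Finset.mem_image_of_mem _ hj)⟩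
  choose y hy using key
  exact ⟨y, fun j hj s => hy s j hj⟩

/-- A set of more than `a` elements can be mapped onto `Fin (a + 1)`. -/
theorem exists_map_onto_fin {M : Type*} {a : ℕ} (S : Finset M) (hS : a < S.card) :
    ∃ g : M → Fin (a + 1), ∀ v, ∃ p ∈ S, g p = v := by
  classical
  let e := S.equivFin
  refine ⟨fun p => if h : p ∈ S then Fin.ofNat (a + 1) (e ⟨p, h⟩) else 0, fun v => ?_⟩
  refine ⟨(e.symm ⟨v, by omega⟩).1, (e.symm ⟨v, by omega⟩).2, ?_⟩
  simp

/-- A set of `a` elements of `Fin (a + 1)` misses some element. -/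
theorem exists_notMem_of_card {a : ℕ} (y : {y : Finset (Fin (a + 1)) // y.card = a}) :
    ∃ v, v ∉ y.1 := by
  by_contra! h
  have := y.2
  rw [Finset.eq_univ_iff_forall.2 h] at this
  simp at this

/-- The list channel achieves every channel whose inputs can be encoded in a finite set so that
the inputs represented by any `b` codes have a common output. -/
theorem listChannel_achieves_of_common_output {X : Type*} {Y : Type*} {M : Type*} [Finite M]
    {b : ℕ} (hb : 0 < b) (V : Channel X Y) (f : X → M)
    (h : ∀ S : Finset M, S.card ≤ b → ∃ y, ∀ x, f x ∈ S → V.rel x y) :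
    (listChannel b (b + 1) hb b.lt_succ_self).Achieves V := by
  classical
  have := Fintype.ofFinite M
  -- One invocation per map `g : M → Fin (b + 1)`, transmitting `g p`. If more than `b` codes
  -- survived, some `g` would map them onto `Fin (b + 1)`, but the list received for `g` omits a
  -- value.
  let e := Fintype.equivFin (M → Fin (b + 1))
  have hcard (z : Fin (Fintype.card (M → Fin (b + 1))) →
      {y : Finset (Fin (b + 1)) // y.card = b}) :
      (Finset.univ.filter fun p : M => ∀ s, e.symm s p ∈ (z s).1).card ≤ b := by
    by_contra! hlt
    obtain ⟨g, hg⟩ := exists_map_onto_fin _ hlt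
    obtain ⟨v, hv⟩ := exists_notMem_of_card (z (e g))
    obtain ⟨p, hp, rfl⟩ := hg v
    simpa using hv (by simpa using (Finset.mem_filter.1 hp).2 (e g))
  refine ⟨_, fun x s => e.symm s (f x), fun z => (h _ (hcard z)).choose, fun x z hz => ?_⟩
  exact (h _ (hcard z)).choose_spec x (by simpa using show ∀ s, e.symm s (f x) ∈ (z s).1 from hz)

/-- Up to `a` inputs of a channel achieved by the list channel have a common output. -/
theorem exists_common_output_of_listChannel_achieves {X : Type*} {Y : Type*} {ι : Type*}
    [Fintype ι] {a : ℕ} (ha : 0 < a) {V : Channel X Y}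
    (h : (listChannel a (a + 1) ha a.lt_succ_self).Achieves V) (hι : Fintype.card ι ≤ a)
    (x : ι → X) : ∃ y, ∀ j, V.rel (x j) y := by
  obtain ⟨k, enc, dec, H⟩ := h
  obtain ⟨y, hy⟩ := exists_common_output_listChannel (Finset.univ : Finset ι)
    (by simpa using hι) (fun j => enc (x j))
  exact ⟨dec y, fun j => H _ _ fun s => hy j (Finset.mem_univ _) s⟩

/-- A channel achieved by the trivial channel has an output common to all inputs. -/
theorem exists_common_output_of_trivialChannel_achieves {X : Type*} {Y : Type*} {V : Channel X Y}
    (h : trivialChannel.Achieves V) : ∃ y, ∀ x, V.rel x y := by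
  obtain ⟨k, enc, dec, H⟩ := h
  exact ⟨dec fun _ => (), fun x => H _ _ fun _ => trivial⟩

/-- A channel with an output common to all inputs is achieved by the trivial channel. -/
theorem trivialChannel_achieves_of_common_output {X : Type*} {Y : Type*} {V : Channel X Y}
    (h : ∃ y, ∀ x, V.rel x y) : trivialChannel.Achieves V :=
  ⟨0, fun _ _ => (), fun _ => h.choose, fun x _ _ => h.choose_spec x⟩

/-- Every primitive achieves the trivial channel. -/
theorem Primitive.achieves_trivialChannel {X : Type*} {Y : Type*} (P : Primitive X Y) :
    P.Achieves trivialChannel :=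
  ⟨0, fun _ => Fin.elim0, fun _ => (), fun _ _ _ => trivial⟩

/-- A primitive achieving the list channel with lists of size `a` has, for some number of
invocations, `a + 1` input sequences without common output. -/
theorem Primitive.Achieves.exists_no_common_output {X : Type*} {Y : Type*} {P : Primitive X Y}
    {a : ℕ} {ha : 0 < a} (h : P.Achieves (listChannel a (a + 1) ha a.lt_succ_self)) :
    ∃ (k : ℕ) (x : Fin (a + 1) → Fin k → X), ¬ ∃ y, ∀ j, (P.uses k).rel (x j) y := by
  obtain ⟨k, enc, dec, H⟩ := h
  refine ⟨k, enc, fun ⟨y, hy⟩ => ?_⟩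
  obtain ⟨v, hv⟩ := exists_notMem_of_card (dec y)
  exact hv (H v y (hy v))

/-- A primitive with `a + 1` input sequences without common output achieves the list channel with
lists of size `a`. -/
theorem Primitive.achieves_listChannel {X : Type*} {Y : Type*} {P : Primitive X Y}
    {a : ℕ} (ha : 0 < a) (k : ℕ) (x : Fin (a + 1) → Fin k → X)
    (hx : ∀ y, ∃ j, ¬ (P.uses k).rel (x j) y) :
    P.Achieves (listChannel a (a + 1) ha a.lt_succ_self) := by
  choose j hj using hx
  -- Excluding a single input incompatible with `y` leaves a list of size exactly `a`.
  refine ⟨k, x, fun y => ⟨{j y}ᶜ, by simp [Finset.card_compl]⟩, fun i y hi => ?_⟩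
  have : i ≠ j y := fun h => hj y (h ▸ hi)
  simpa [listChannel] using this

/-- A primitive has at most one ambiguity. -/
theorem Primitive.IsAmbiguity.unique {X : Type*} {Y : Type*} {P : Primitive X Y} {b c : ℕ∞}
    (hb : P.IsAmbiguity b) (hc : P.IsAmbiguity c) : b = c := by
  have le {b c : ℕ∞} (hb : P.IsAmbiguity b) (hc : P.IsAmbiguity c) : c ≤ b := by
    rcases hb with ⟨rfl, -⟩ | ⟨k, hk, rfl, hP, -⟩
    · exact le_top
    -- These `k + 1` inputs would share an output if a list channel with `l > k`, or the trivial
    -- channel, simulated `P`.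
    obtain ⟨m, x, hx⟩ := hP.exists_no_common_output
    rcases hc with ⟨-, -, h⟩ | ⟨l, hl, rfl, -, h⟩
    · obtain ⟨y, hy⟩ := exists_common_output_of_trivialChannel_achieves (h m)
      exact absurd ⟨y, fun j => hy (x j)⟩ hx
    · by_contra! hlt
      exact hx (exists_common_output_of_listChannel_achieves hl (h m)
        (by simpa using Nat.cast_lt.1 hlt) x)
  exact le_antisymm (le hc hb) (le hb hc)

/-- A channel achieving a list channel has an input. -/
theorem Channel.Achieves.nonempty_input {X : Type*} {Y : Type*} {W : Channel X Y}
    {a : ℕ} {ha : 0 < a} (h : W.Achieves (listChannel a (a + 1) ha a.lt_succ_self)) :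
    Nonempty X := by
  by_contra! hX
  obtain ⟨k, x, hx⟩ := Primitive.Achieves.exists_no_common_output h
  exact hx ⟨fun s => isEmptyElim (x 0 s), fun j s => isEmptyElim (x j s)⟩

/-- A channel achieving the list channel with lists of size `a` can transmit the elements of any
finite set so that at most `a` of them are consistent with the output. -/
theorem Channel.Achieves.exists_code {X : Type*} {Y : Type*} {W : Channel X Y}
    {a : ℕ} {ha : 0 < a} (h : W.Achieves (listChannel a (a + 1) ha a.lt_succ_self))
    (M : Type) [Fintype M] [DecidableEq M] :
    ∃ (k : ℕ) (enc : M → Fin k → X), ∀ (y : Fin k → Y) (S : Finset M),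
      (∀ p ∈ S, ∀ s, W.rel (enc p s) (y s)) → S.card ≤ a := by
  obtain ⟨k, x, hx⟩ := Primitive.Achieves.exists_no_common_output h
  -- One block of `k` uses per map `g`, carrying `x (g p)`. If `g` maps the consistent messages onto
  -- `Fin (a + 1)`, the output of its block is common to all `x v`.
  let e := Fintype.equivFin ((M → Fin (a + 1)) × Fin k)
  refine ⟨_, fun p s => x ((e.symm s).1 p) (e.symm s).2, fun y S hS => ?_⟩
  by_contra! hlt
  obtain ⟨g, hg⟩ := exists_map_onto_fin S hlt
  refine hx ⟨fun s => y (e (g, s)), fun v s => ?_⟩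
  obtain ⟨p, hp, rfl⟩ := hg v
  simpa using hS p hp (e (g, s))

/-- `d` messages can be distributed to `n` channels of capacity `a` such that every message is
left out by at most `t` channels, provided that the total capacity suffices. -/
theorem exists_assignment {n t a d : ℕ} (htn : t < n) (h : d * (n - t) ≤ n * a) :
    ∃ C : Fin d → Finset (Fin n), (∀ j, (C j).card ≤ t) ∧
      ∀ i, (Finset.univ.filter fun j => i ∉ C j).card ≤ a := by
  classical
  have hr : 0 < n - t := by omega
  -- Round robin: slot `n * q + i` is the `q`-th use of channel `i`. Message `j` takes the `j`-th
  -- run of `n - t` consecutive slots; as `n - t ≤ n`, these lie on distinct channels.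
  let G (j : Fin d) : Finset (Fin n) :=
    Finset.univ.filter fun i => ∃ q < a, (n * q + i) / (n - t) = j
  have hG (j : Fin d) : n - t ≤ (G j).card := by
    have hn : 0 < n := by omega
    rw [← Finset.card_range (n - t)]
    refine Finset.card_le_card_of_injOn
      (fun r => ⟨(j * (n - t) + r) % n, Nat.mod_lt _ hn⟩) (fun r hr' => ?_) ?_
    · have hr'' : r < n - t := by simpa using hr'
      simp only [G, Finset.coe_filter, Set.mem_ofPred_eq, Finset.mem_univ, true_and]
      refine ⟨(j * (n - t) + r) / n, ?_, ?_⟩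
      · rw [Nat.div_lt_iff_lt_mul hn, mul_comm a]
        have : (j + 1) * (n - t) ≤ d * (n - t) := Nat.mul_le_mul_right _ j.2
        rw [add_mul, one_mul] at this
        omega
      · rw [Nat.div_add_mod, mul_comm, Nat.mul_add_div hr, Nat.div_eq_of_lt hr'', add_zero]
    · intro r hr1 s hs1 hrs
      have hr2 : r < n - t := by simpa using hr1
      have hs2 : s < n - t := by simpa using hs1
      have : r ≡ s [MOD n] := Nat.ModEq.add_left_cancel' (j * (n - t)) (by simpa [Nat.ModEq] using hrs)
      exact this.eq_of_lt_of_lt (by omega) (by omega)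
  refine ⟨fun j => (G j)ᶜ, fun j => ?_, fun i => ?_⟩
  · have := hG j
    rw [Finset.card_compl, Fintype.card_fin]
    omega
  · rw [← Finset.card_map Fin.valEmbedding]
    refine (Finset.card_le_card (t := (Finset.range a).image fun q => (n * q + i) / (n - t))
      fun j hj => ?_).trans (Finset.card_image_le.trans (by simp))
    obtain ⟨j', hj', rfl⟩ := Finset.mem_map.1 hj
    simpa [G] using hj'

/-- If all channels achieve the list channel with lists of size `a`, then their parallel
concatenation achieves every list channel with lists of size `b` for which
`n * a < (b + 1) * (n - t)`. -/
theorem parallel_achieves_listChannel {n t a b : ℕ} (ha : 0 < a) (hb : 0 < b)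
    {X : Fin n → Type*} {Y : Fin n → Type*} (W : ∀ i, Channel (X i) (Y i))
    (h : ∀ i, (W i).Achieves (listChannel a (a + 1) ha a.lt_succ_self))
    (hab : n * a < (b + 1) * (n - t)) :
    (parallel W t).Achieves (listChannel b (b + 1) hb b.lt_succ_self) := by
  classical
  have hX (i) : Nonempty (X i) := (h i).nonempty_input
  choose k enc henc using fun i => (h i).exists_code (Fin (b + 1))
  have hk (i) : k i ≤ Finset.univ.sup k := Finset.le_sup (Finset.mem_univ i)
  -- Codes shorter than the longest one are padded with an arbitrary input; only their first `k i`
  -- outputs are used below.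
  refine Primitive.achieves_listChannel hb (Finset.univ.sup k)
    (fun j s i => if hs : s.1 < k i then enc i j ⟨s, hs⟩ else (hX i).some) fun y => ?_
  by_contra! hy
  choose C hC hrel using hy
  have hle (i : Fin n) : (Finset.univ.filter fun j => i ∉ C j).card ≤ a := by
    refine henc i (fun s => y (Fin.castLE (hk i) s) i) _ fun j hj s => ?_
    simpa using hrel j i (by simpa using hj) (Fin.castLE (hk i) s)
  have hge (j : Fin (b + 1)) : n - t ≤ (Finset.univ.filter fun i => i ∉ C j).card := by
    have := hC j
    rw [Finset.filter_not, Finset.filter_univ_mem, ← Finset.compl_eq_univ_sdiff,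
      Finset.card_compl, Fintype.card_fin]
    omega
  have h1 : (b + 1) * (n - t) ≤ ∑ j, (Finset.univ.filter fun i => i ∉ C j).card := by
    simpa using Finset.card_nsmul_le_sum Finset.univ _ _ fun j _ => hge j
  have h2 : ∑ i, (Finset.univ.filter fun j => i ∉ C j).card ≤ n * a := by
    simpa using Finset.sum_le_card_nsmul Finset.univ _ _ fun i _ => hle i
  have h3 := Finset.sum_card_bipartiteAbove_eq_sum_card_bipartiteBelow
    (s := Finset.univ) (t := Finset.univ) (fun (j : Fin (b + 1)) (i : Fin n) => i ∉ C j)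
  simp only [Finset.bipartiteAbove, Finset.bipartiteBelow] at h3
  omega

/-- If all channels are achieved by the list channel with lists of size `a`, then any number of
uses of their parallel concatenation is achieved by every list channel with lists of size `b` for
which `b * (n - t) ≤ n * a`. -/
theorem listChannel_achieves_parallel {n t a b : ℕ} (htn : t < n) (ha : 0 < a) (hb : 0 < b)
    {X : Fin n → Type*} {Y : Fin n → Type*} (W : ∀ i, Channel (X i) (Y i))
    (h : ∀ i, (listChannel a (a + 1) ha a.lt_succ_self).Achieves (W i))
    (hab : b * (n - t) ≤ n * a) (m : ℕ) :
    (listChannel b (b + 1) hb b.lt_succ_self).Achieves ((parallel W t).uses m) := by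
  classical
  choose k enc dec H using h
  refine listChannel_achieves_of_common_output
    -- The code of an input is all that its simulation sends over the list channels: a finite set
    -- even if `X i` is infinite.
    (M := ∀ i, Fin m × Fin (k i) → Fin (a + 1)) hb _
    (fun x i s => enc i (x s.1 i) s.2) fun S hS => ?_
  obtain ⟨C, hC, hcap⟩ := exists_assignment (d := S.card) htn
    ((Nat.mul_le_mul_right _ hS).trans hab)
  let e := S.equivFin
  -- On channel `i` only the at most `a` codes not treating it as corrupted must share an output.
  choose z hz using fun i => exists_common_output_listChannel _ (hcap i)
    (fun j => (e.symm j).1 i)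
  refine ⟨fun s i => dec i fun l => z i (s, l), fun x hx => ⟨C (e ⟨_, hx⟩), hC _, ?_⟩⟩
  intro i hi s
  refine H i _ _ fun l => ?_
  have := hz i (e ⟨_, hx⟩) (by simpa using hi) (s, l)
  rw [Equiv.symm_apply_apply] at this
  exact this

/-- The parallel concatenation of channels of equal ambiguity has the expected ambiguity. -/
theorem parallel_isAmbiguity {n t : ℕ} (htn : t < n) {X : Fin n → Type*} {Y : Fin n → Type*}
    (W : ∀ i, Channel (X i) (Y i)) (A : ℕ∞) (hA : ∀ i, (W i).IsAmbiguity A) :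
    (parallel W t).IsAmbiguity
      (ENat.map (fun a : ℕ => ⌊(n : ℚ) / ((n : ℚ) - (t : ℚ)) * (a : ℚ)⌋₊) A) := by
  have hr : 0 < n - t := by omega
  rcases hA ⟨t, htn⟩ with ⟨rfl, -⟩ | ⟨a, ha, rfl, -⟩
  · have htriv (i) : ∃ y, ∀ x, (W i).rel x y := by
      rcases hA i with ⟨-, hi⟩ | ⟨a, -, hi, -⟩
      · exact exists_common_output_of_trivialChannel_achieves hi.2
      · simp at hi
    choose y hy using htriv
    exact Or.inl ⟨rfl, Primitive.achieves_trivialChannel _, fun m =>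
      trivialChannel_achieves_of_common_output
        ⟨fun _ => y, fun x => ⟨∅, by simp, fun i _ s => hy i _⟩⟩⟩
  · have heq (i) : (W i).Equivalent (listChannel a (a + 1) ha a.lt_succ_self) := by
      rcases hA i with ⟨hi, -⟩ | ⟨c, hc, hi, h⟩
      · simp at hi
      · obtain rfl : a = c := by exact_mod_cast hi
        exact h
    have hfloor : ⌊(n : ℚ) / ((n : ℚ) - (t : ℚ)) * (a : ℚ)⌋₊ = n * a / (n - t) := by
      rw [← Nat.floor_div_eq_div (K := ℚ), Nat.cast_sub htn.le, Nat.cast_mul, div_mul_eq_mul_div]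
    have hb : 0 < n * a / (n - t) :=
      Nat.div_pos ((Nat.sub_le n t).trans (Nat.le_mul_of_pos_right n ha)) hr
    rw [ENat.map_natCast, hfloor]
    refine Or.inr ⟨_, hb, rfl, parallel_achieves_listChannel ha hb W (fun i => (heq i).1) ?_,
      listChannel_achieves_parallel htn ha hb W (fun i => (heq i).2) (Nat.div_mul_le_self _ _)⟩
    rw [mul_comm (_ + 1)]
    exact Nat.lt_mul_div_succ _ hr

end ZeroError

theorem mainTheorem7 {n t : ℕ} (htn : t < n)
    {X : Fin n → Type*} {Y : Fin n → Type*}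
    (W : ∀ i, ZeroError.Channel (X i) (Y i)) (A : ℕ∞)
    (hA : ∀ i, (W i).IsAmbiguity A) (b : ℕ∞) :
    (ZeroError.parallel W t).IsAmbiguity b ↔
      b = ENat.map (fun a : ℕ => ⌊(n : ℚ) / ((n : ℚ) - (t : ℚ)) * (a : ℚ)⌋₊) A :=
  ⟨fun h => h.unique (ZeroError.parallel_isAmbiguity htn W A hA),
    fun h => h ▸ ZeroError.parallel_isAmbiguity htn W A hA⟩
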